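/- Let $M$ be a closed connected smooth manifold with base point $x_0$, let $\pi=\pi_1(M,x_0)$ and let $u\in H^1(M;\mathbf R)\cong \mathrm{Hom}(\pi,\mathbf R)$. Put $\Lambda=\mathbf Z[\pi]$, and let $\Lambda_u$ be the completed ring of all formal series $\lambda=\sum_{g\in\pi} n_g\,g$ with $n_g\in\mathbf Z$ such that for every $A\in\mathbf R$ there are only finitely many $g\in\pi$ with $n_g\neq 0$ and $u(g)<A$. Fix a $\mathcal C^1$-triangulation of $M$ and lift it to the universal cover $\widetilde M$; let $C_\bullet(M)$ be the simplicial chain complex of $\widetilde M$ with respect to the lifted triangulation, a complex of left $\Lambda$-modules through the action of $\pi$ by deck transformations. The Novikov homology $H_*(M,u)$ is the homology of the complex $C_\bullet(M,u)=\Lambda_u\otimes_\Lambda C_\bullet(M)$ of left $\Lambda_u$-modules. If $H_i(M,u)=0$ for all $i\ge 0$, for some class $u$, then the Euler characteristic $\chi(M)=\sum_{i\ge 0}(-1)^i\,\mathrm{rank}\,H_i(M;\mathbf Z)$ is zero, where $H_*(M;\mathbf Z)$ is the simplicial homology of the triangulation. -/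

import Mathlib

noncomputable section

namespace Novikov

section Ring

variable {G : Type*} [Group G]

/-- `u(gᵢ) → +∞` along the support of the formal series `∑ a(g) g`: for every `A`, only finitely many
group elements with `u(g) < A` appear with a non-zero coefficient. -/
def TendsToInfinity (u : G →* Multiplicative ℝ) (a : G → ℤ) : Prop :=
  ∀ A : ℝ, {g : G | a g ≠ 0 ∧ (u g).toAdd < A}.Finite

/-- The formal series over `G` along which `u` tends to `+∞`, as a subgroup of `ℤ[[G]] = (G → ℤ)`. -/
def novikovSubgroup (u : G →* Multiplicative ℝ) : AddSubgroup (G → ℤ) where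
  carrier := {a | TendsToInfinity u a}
  zero_mem' A := by simp
  add_mem' {a b} ha hb A := by
    refine ((ha A).union (hb A)).subset ?_
    rintro g ⟨hg, hA⟩
    by_cases h : a g = 0
    · exact Or.inr ⟨fun h' => hg (by simp [h, h']), hA⟩
    · exact Or.inl ⟨h, hA⟩
  neg_mem' {a} ha A := by simpa using ha A

/-- The completed ring `Λ_u` of the group ring `Λ = ℤ[G]` with respect to `u : G → ℝ`. -/
def NovikovRing (u : G →* Multiplicative ℝ) : Type _ := novikovSubgroup u

namespace NovikovRing

variable {u : G →* Multiplicative ℝ}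

instance : AddCommGroup (NovikovRing u) := inferInstanceAs (AddCommGroup (novikovSubgroup u))

/-- The coefficient of `g` in a formal series. -/
def coeff (a : NovikovRing u) (g : G) : ℤ := a.1 g

@[ext] theorem ext {a b : NovikovRing u} (h : ∀ g, a.coeff g = b.coeff g) : a = b :=
  Subtype.ext (funext h)

@[simp] theorem coeff_add (a b : NovikovRing u) (g : G) : (a + b).coeff g = a.coeff g + b.coeff g :=
  rfl

@[simp] theorem coeff_zero (g : G) : (0 : NovikovRing u).coeff g = 0 := rfl

theorem finite (a : NovikovRing u) (A : ℝ) : {g : G | a.coeff g ≠ 0 ∧ (u g).toAdd < A}.Finite :=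
  a.2 A

theorem exists_lower_bound (a : NovikovRing u) : ∃ B : ℝ, ∀ g, a.coeff g ≠ 0 → B ≤ (u g).toAdd := by
  obtain ⟨B, hB⟩ := ((a.finite 0).image fun g => (u g).toAdd).bddBelow
  refine ⟨min B 0, fun g hg => ?_⟩
  by_cases h : (u g).toAdd < 0
  · exact (min_le_left _ _).trans (hB ⟨g, ⟨hg, h⟩, rfl⟩)
  · exact (min_le_right _ _).trans (not_lt.1 h)

theorem finite_pairs (a b : NovikovRing u) (A : ℝ) :
    {q : G × G | a.coeff q.1 ≠ 0 ∧ b.coeff q.2 ≠ 0 ∧ (u (q.1 * q.2)).toAdd < A}.Finite := by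
  obtain ⟨B, hB⟩ := a.exists_lower_bound
  obtain ⟨C, hC⟩ := b.exists_lower_bound
  refine ((a.finite (A - C)).prod (b.finite (A - B))).subset ?_
  rintro ⟨x, y⟩ ⟨hx, hy, h⟩
  have h1 := hB x hx
  have h2 := hC y hy
  simp only [map_mul, toAdd_mul] at h
  exact ⟨⟨hx, by linarith⟩, ⟨hy, by linarith⟩⟩

theorem finite_factorizations (a b : NovikovRing u) (g : G) :
    (fun h => a.coeff h * b.coeff (h⁻¹ * g)).HasFiniteSupport := by
  refine Set.Finite.of_finite_image (f := fun h => (h, h⁻¹ * g)) ?_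
    (fun x _ y _ h => (Prod.mk.inj h).1)
  refine (finite_pairs a b ((u g).toAdd + 1)).subset ?_
  rintro _ ⟨h, hh, rfl⟩
  exact ⟨left_ne_zero_of_mul hh, right_ne_zero_of_mul hh, by simp⟩

/-- The product of formal series: the coefficient of `g` in `a * b` is `∑_{xy = g} a(x) b(y)`, a sum
with finitely many non-zero terms. -/
instance : Mul (NovikovRing u) where
  mul a b := ⟨fun g => ∑ᶠ h : G, a.coeff h * b.coeff (h⁻¹ * g), fun A => by
    refine ((finite_pairs a b A).image fun q => q.1 * q.2).subset ?_
    rintro g ⟨hg, hA⟩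
    obtain ⟨h, hh⟩ := not_forall.1 (mt finsum_eq_zero_of_forall_eq_zero hg)
    exact ⟨(h, h⁻¹ * g), ⟨left_ne_zero_of_mul hh, right_ne_zero_of_mul hh, by simpa using hA⟩,
      by simp⟩⟩

theorem coeff_mul (a b : NovikovRing u) (g : G) :
    (a * b).coeff g = ∑ᶠ h : G, a.coeff h * b.coeff (h⁻¹ * g) := rfl

open Classical in
/-- The group element `g` as a formal series. -/
def single (u : G →* Multiplicative ℝ) (g : G) : NovikovRing u :=
  ⟨Pi.single g 1, fun A => (Set.finite_singleton g).subset (by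
    rintro h ⟨hh, -⟩
    by_contra hne
    exact hh (Pi.single_eq_of_ne hne 1))⟩

open Classical in
theorem coeff_single_self (g : G) : (single u g).coeff g = 1 := Pi.single_eq_same g 1

open Classical in
theorem coeff_single_of_ne {g h : G} (hne : h ≠ g) : (single u g).coeff h = 0 :=
  Pi.single_eq_of_ne hne 1

instance : One (NovikovRing u) := ⟨single u 1⟩

theorem one_def : (1 : NovikovRing u) = single u 1 := rfl

theorem coeff_single_mul (g : G) (a : NovikovRing u) (h : G) :
    (single u g * a).coeff h = a.coeff (g⁻¹ * h) := by
  rw [coeff_mul, finsum_eq_single _ g, coeff_single_self, one_mul]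
  intro x hx
  rw [coeff_single_of_ne hx, zero_mul]

theorem coeff_mul_single (g : G) (a : NovikovRing u) (h : G) :
    (a * single u g).coeff h = a.coeff (h * g⁻¹) := by
  rw [coeff_mul, finsum_eq_single _ (h * g⁻¹)]
  · rw [show (h * g⁻¹)⁻¹ * h = g by group, coeff_single_self, mul_one]
  · intro x hx
    rw [coeff_single_of_ne, mul_zero]
    rintro rfl
    exact hx (by group)

theorem mul_assoc' (a b c : NovikovRing u) : a * b * c = a * (b * c) := by
  ext g
  have hfin : (fun q : G × G => a.coeff q.1 * b.coeff (q.1⁻¹ * q.2) * c.coeff (q.2⁻¹ * g)).HasFiniteSupport := by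
    obtain ⟨C, hC⟩ := c.exists_lower_bound
    refine Set.Finite.of_finite_image (f := fun q : G × G => (q.1, q.1⁻¹ * q.2)) ?_ ?_
    · refine (finite_pairs a b ((u g).toAdd - C + 1)).subset ?_
      rintro _ ⟨⟨x, y⟩, hxy, rfl⟩
      have hc := hC _ (right_ne_zero_of_mul hxy)
      have hab := left_ne_zero_of_mul hxy
      refine ⟨left_ne_zero_of_mul hab, right_ne_zero_of_mul hab, ?_⟩
      simp only [map_mul, map_inv, toAdd_mul, toAdd_inv] at hc ⊢
      linarith
    · rintro ⟨x, y⟩ - ⟨x', y'⟩ - h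
      obtain ⟨rfl, h2⟩ := Prod.mk.inj h
      simpa using h2
  have hfin' := hfin
  simp only [coeff_mul, finsum_mul, mul_finsum]
  have e1 := finsum_curry _ hfin
  have e2 := finsum_curry (fun q : G × G => a.coeff q.2 * b.coeff (q.2⁻¹ * q.1) * c.coeff (q.1⁻¹ * g))
    (hfin.preimage ((Equiv.prodComm G G).injective.injOn))
  have e3 := finsum_comp_equiv (Equiv.prodComm G G)
    (f := fun q : G × G => a.coeff q.1 * b.coeff (q.1⁻¹ * q.2) * c.coeff (q.2⁻¹ * g))
  refine (e2.symm.trans (e3.trans e1)).trans (finsum_congr fun x => ?_)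
  rw [← finsum_comp_equiv (Equiv.mulLeft x)]
  refine finsum_congr fun y => ?_
  simp [mul_assoc]

instance : Ring (NovikovRing u) where
  left_distrib a b c := by
    ext g
    simp only [coeff_mul, coeff_add, mul_add]
    exact finsum_add_distrib (finite_factorizations a b g) (finite_factorizations a c g)
  right_distrib a b c := by
    ext g
    simp only [coeff_mul, coeff_add, add_mul]
    exact finsum_add_distrib (finite_factorizations a c g) (finite_factorizations b c g)
  zero_mul a := by ext g; simp [coeff_mul]
  mul_zero a := by ext g; simp [coeff_mul]
  mul_assoc := mul_assoc'
  one_mul a := by ext g; simp [one_def, coeff_single_mul]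
  mul_one a := by ext g; simp [one_def, coeff_mul_single]
  zsmul := (inferInstance : AddCommGroup (NovikovRing u)).zsmul
  zsmul_zero' := (inferInstance : AddCommGroup (NovikovRing u)).zsmul_zero'
  zsmul_succ' := (inferInstance : AddCommGroup (NovikovRing u)).zsmul_succ'
  zsmul_neg' := (inferInstance : AddCommGroup (NovikovRing u)).zsmul_neg'
  neg_add_cancel := (inferInstance : AddCommGroup (NovikovRing u)).neg_add_cancel

/-- Group elements multiply in `Λ_u` as they do in `G`. -/
def singleHom (u : G →* Multiplicative ℝ) : G →* NovikovRing u where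
  toFun := single u
  map_one' := rfl
  map_mul' g h := by
    ext x
    rw [coeff_single_mul]
    by_cases hx : x = g * h
    · subst hx
      rw [coeff_single_self, inv_mul_cancel_left, coeff_single_self]
    · rw [coeff_single_of_ne hx, coeff_single_of_ne]
      rintro rfl
      exact hx (by group)

/-- The inclusion of the group ring `Λ = ℤ[G]` into `Λ_u`. -/
def ofGroupRing (u : G →* Multiplicative ℝ) : MonoidAlgebra ℤ G →+* NovikovRing u :=
  (MonoidAlgebra.lift ℤ (NovikovRing u) G (singleHom u)).toRingHom

end NovikovRing

end Ring

section BaseChange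

open TensorProduct CategoryTheory

universe w w₁ w₂

variable {R : Type w₁} {S : Type w₂} [Ring R] [Ring S] (f : R →+* S)

/-- The relations `(s · f(r)) ⊗ c = s ⊗ (r c)` in `S ⊗_ℤ C`. -/
def balancingRelations (C : Type*) [AddCommGroup C] [Module R C] : Submodule S (S ⊗[ℤ] C) :=
  Submodule.span S {z | ∃ (s : S) (r : R) (c : C), z = (s * f r) ⊗ₜ[ℤ] c - s ⊗ₜ[ℤ] (r • c)}

/-- The left `S`-module `S ⊗_R C`, for a homomorphism `f : R → S` of not necessarily commutative rings
and a left `R`-module `C`. -/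
def BaseChange (C : Type*) [AddCommGroup C] [Module R C] : Type _ :=
  (S ⊗[ℤ] C) ⧸ balancingRelations f C

instance (C : Type*) [AddCommGroup C] [Module R C] : AddCommGroup (BaseChange f C) :=
  inferInstanceAs (AddCommGroup ((S ⊗[ℤ] C) ⧸ balancingRelations f C))

instance (C : Type*) [AddCommGroup C] [Module R C] : Module S (BaseChange f C) :=
  inferInstanceAs (Module S ((S ⊗[ℤ] C) ⧸ balancingRelations f C))

namespace BaseChange

variable {C D E : Type*} [AddCommGroup C] [Module R C] [AddCommGroup D] [Module R D]
  [AddCommGroup E] [Module R E]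

/-- The class of `s ⊗ c` in `S ⊗_R C`. -/
def tmul (s : S) (c : C) : BaseChange f C := (balancingRelations f C).mkQ (s ⊗ₜ[ℤ] c)

/-- The map `id ⊗ g : S ⊗_R C → S ⊗_R D`. -/
def map (g : C →ₗ[R] D) : BaseChange f C →ₗ[S] BaseChange f D :=
  (balancingRelations f C).mapQ (balancingRelations f D)
    (TensorProduct.AlgebraTensorModule.map LinearMap.id g.toAddMonoidHom.toIntLinearMap) (by
      refine Submodule.span_le.2 ?_
      rintro _ ⟨s, r, c, rfl⟩
      refine Submodule.subset_span ⟨s, r, g c, ?_⟩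
      simp)

@[simp] theorem map_tmul (g : C →ₗ[R] D) (s : S) (c : C) :
    map f g (tmul f s c) = tmul f s (g c) := rfl

theorem hom_ext {N : Type*} [AddCommGroup N] [Module S N] {φ ψ : BaseChange f C →ₗ[S] N}
    (h : ∀ s c, φ (tmul f s c) = ψ (tmul f s c)) : φ = ψ := by
  refine Submodule.linearMap_qext _ (TensorProduct.AlgebraTensorModule.ext fun s c => h s c)

theorem map_id : map f (LinearMap.id : C →ₗ[R] C) = LinearMap.id :=
  hom_ext f fun _ _ => rfl

theorem map_comp (h : D →ₗ[R] E) (g : C →ₗ[R] D) : map f (h ∘ₗ g) = map f h ∘ₗ map f g :=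
  hom_ext f fun _ _ => rfl

theorem map_add (g h : C →ₗ[R] D) : map f (g + h) = map f g + map f h :=
  hom_ext f fun s c => by
    have : tmul f s (g c + h c) = tmul f s (g c) + tmul f s (h c) := by
      simp only [tmul, TensorProduct.tmul_add, _root_.map_add]
      rfl
    simpa using this

end BaseChange

/-- The functor `S ⊗_R -` from left `R`-modules to left `S`-modules. -/
def baseChangeFunctor : ModuleCat.{w} R ⥤ ModuleCat.{max w₂ w} S where
  obj C := ModuleCat.of S (BaseChange f C)
  map g := ModuleCat.ofHom (BaseChange.map f g.hom)
  map_id C := by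
    ext1
    exact BaseChange.map_id f
  map_comp g h := by
    ext1
    exact BaseChange.map_comp f h.hom g.hom

instance : (baseChangeFunctor.{w} f).Additive where
  map_add {_ _ g h} := by
    ext1
    exact BaseChange.map_add f g.hom h.hom

end BaseChange

section Chains

open CategoryTheory

universe v w

/-- A sequence of sets of (ordered) simplices with face maps: a `Δ`-complex. -/
structure DeltaSet where
  /-- The set of `n`-simplices. -/
  simplex : ℕ → Type v
  /-- The `i`-th face of an `(n+1)`-simplex. -/
  face : ∀ {n : ℕ}, Fin (n + 2) → simplex (n + 1) → simplex n
  face_face : ∀ {n : ℕ} (x : simplex (n + 2)) (i j : Fin (n + 2)), i ≤ j →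
    face i (face j.succ x) = face j (face i.castSucc x)

namespace DeltaSet

variable (X : DeltaSet.{v})

/-- The boundary `∂x = ∑ (-1)ⁱ dᵢ x`. -/
def boundary (n : ℕ) : (X.simplex (n + 1) →₀ ℤ) →ₗ[ℤ] (X.simplex n →₀ ℤ) :=
  ∑ i : Fin (n + 2), (-1 : ℤ) ^ (i : ℕ) • Finsupp.lmapDomain ℤ ℤ (X.face i)

theorem boundary_boundary (n : ℕ) : X.boundary n ∘ₗ X.boundary (n + 1) = 0 := by
  refine Finsupp.lhom_ext' fun x => LinearMap.ext_ring ?_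
  simp only [boundary, LinearMap.comp_apply, LinearMap.sum_apply, LinearMap.smul_apply,
    Finsupp.lsingle_apply, Finsupp.lmapDomain_apply, Finsupp.mapDomain_single, map_sum, map_smul,
    LinearMap.zero_apply, Finset.smul_sum, smul_smul]
  rw [← Finset.sum_product', Finset.univ_product_univ]
  let S : Finset (Fin (n + 3) × Fin (n + 2)) := {q | (q.1 : ℕ) ≤ q.2}
  rw [← Finset.sum_add_sum_compl S, ← eq_neg_iff_add_eq_zero, ← Finset.sum_neg_distrib]
  refine Finset.sum_bij
    (fun q hq => (q.2.succ, q.1.castLT (lt_of_le_of_lt (Finset.mem_filter.1 hq).2 q.2.2))) ?_ ?_ ?_ ?_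
  · rintro ⟨i, j⟩ hq
    simp [S] at hq ⊢
    omega
  · rintro ⟨i, j⟩ hq ⟨i', j'⟩ hq' h
    simp [Fin.ext_iff] at h ⊢
    omega
  · rintro ⟨i, j⟩ hq
    simp [S] at hq
    refine ⟨(j.castSucc, i.pred ?_), ?_, ?_⟩
    · rintro rfl
      simp at hq
    · simp [S]
      omega
    · simp
  · rintro ⟨i, j⟩ hq
    have hle : i.castLT (lt_of_le_of_lt (Finset.mem_filter.1 hq).2 j.2) ≤ j :=
      Fin.le_def.2 (Finset.mem_filter.1 hq).2
    have := X.face_face x _ j hle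
    simp only [Fin.castSucc_castLT] at this
    simp only [this, Fin.val_succ, Fin.val_castLT, pow_succ, ← neg_smul]
    congr 1
    ring

/-- The chain complex of integral chains of a `Δ`-complex. -/
def chainComplex : ChainComplex (ModuleCat.{v} ℤ) ℕ :=
  ChainComplex.of (fun n => ModuleCat.of ℤ (X.simplex n →₀ ℤ))
    (fun n => ModuleCat.ofHom (X.boundary n)) (fun n => by
      ext1
      exact X.boundary_boundary n)

end DeltaSet

/-- A `Δ`-complex with an action of `G` by automorphisms. -/
structure EquivariantDeltaSet (G : Type w) [Group G] extends DeltaSet.{v} where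
  action : ∀ n, MulAction G (simplex n)
  face_smul : ∀ {n : ℕ} (i : Fin (n + 2)) (g : G) (x : simplex (n + 1)),
    face i (g • x) = g • face i x

attribute [instance] EquivariantDeltaSet.action

/-- The permutation representation of `G` on the free abelian group on a `G`-set `X`. -/
def permRep (G : Type*) [Group G] (X : Type*) [MulAction G X] : Representation ℤ G (X →₀ ℤ) where
  toFun g := Finsupp.lmapDomain ℤ ℤ (g • ·)
  map_one' := by
    refine Finsupp.lhom_ext' fun x => LinearMap.ext_ring ?_
    simp
  map_mul' g h := by
    refine Finsupp.lhom_ext' fun x => LinearMap.ext_ring ?_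
    simp [mul_smul]

namespace EquivariantDeltaSet

variable {G : Type w} [Group G] (X : EquivariantDeltaSet.{v} G)

theorem boundary_permRep (n : ℕ) (g : G) (c : X.simplex (n + 1) →₀ ℤ) :
    X.boundary n (permRep G _ g c) = permRep G _ g (X.boundary n c) := by
  suffices h : X.boundary n ∘ₗ permRep G _ g = permRep G _ g ∘ₗ X.boundary n from
    LinearMap.congr_fun h c
  refine Finsupp.lhom_ext' fun x => LinearMap.ext_ring ?_
  simp [DeltaSet.boundary, permRep, X.face_smul]

/-- The boundary as a homomorphism of modules over the group ring. -/
def equivariantBoundary (n : ℕ) : (permRep G (X.simplex (n + 1))).asModule →ₗ[MonoidAlgebra ℤ G]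
    (permRep G (X.simplex n)).asModule :=
  MonoidAlgebra.equivariantOfLinearOfComm
    ((permRep G (X.simplex n)).asModuleEquiv.symm.toLinearMap ∘ₗ X.boundary n ∘ₗ
      (permRep G (X.simplex (n + 1))).asModuleEquiv.toLinearMap) (fun g c => by
      apply (permRep G (X.simplex n)).asModuleEquiv.injective
      simp only [Representation.asModuleEquiv_map_smul, Representation.asAlgebraHom_single_one,
        LinearMap.comp_apply, LinearEquiv.coe_coe]
      exact X.boundary_permRep n g c)

/-- The chain complex of `X` as a complex of left `ℤ[G]`-modules. -/
def equivariantChainComplex : ChainComplex (ModuleCat.{v} (MonoidAlgebra ℤ G)) ℕ :=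
  ChainComplex.of (fun n => ModuleCat.of (MonoidAlgebra ℤ G) (permRep G (X.simplex n)).asModule)
    (fun n => ModuleCat.ofHom (X.equivariantBoundary n)) (fun n => by
      ext1
      exact LinearMap.ext fun c => LinearMap.congr_fun (X.boundary_boundary n) c)

/-- The complex `Λ_u ⊗_Λ C_•`, where `Λ = ℤ[G]` and `C_•` is the chain complex of `X`. -/
def completedChainComplex (u : G →* Multiplicative ℝ) :
    ChainComplex (ModuleCat.{max w v} (NovikovRing u)) ℕ :=
  ((baseChangeFunctor.{v} (NovikovRing.ofGroupRing u)).mapHomologicalComplex _).obj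
    X.equivariantChainComplex

end EquivariantDeltaSet

end Chains

section UniversalCover

universe v w

/-- The fundamental group with the product `γ γ' = γ followed by γ'` (Mathlib composes loops in the
other order). -/
abbrev PiOne (X : Type*) [TopologicalSpace X] (x₀ : X) : Type _ := (FundamentalGroup X x₀)ᵐᵒᵖ

/-- A universal covering of `X`, with a base point above `x₀`. -/
structure UniversalCover (X : Type v) [TopologicalSpace X] (x₀ : X) where
  /-- The total space. -/
  space : Type w
  [topology : TopologicalSpace space]
  [simplyConnected : SimplyConnectedSpace space]
  /-- The covering projection. -/
  proj : space → X
  isCoveringMap : IsCoveringMap proj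
  /-- The base point. -/
  base : space
  proj_base : proj base = x₀

attribute [instance] UniversalCover.topology UniversalCover.simplyConnected

namespace UniversalCover

variable {X : Type v} [TopologicalSpace X] {x₀ : X} (U : UniversalCover.{v, w} X x₀)

instance [LocallyPathConnectedSpace X] : LocallyPathConnectedSpace U.space :=
  letI : ChartedSpace X U.space :=
    { atlas := Set.univ
      chartAt := fun e => (U.isCoveringMap.isLocalHomeomorph e).choose
      mem_chart_source := fun e => (U.isCoveringMap.isLocalHomeomorph e).choose_spec.1
      chart_mem_atlas := fun _ => Set.mem_univ _ }
  ChartedSpace.locallyPathConnectedSpace X U.space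

/-- The end point of the lift of the loop `γ` that starts at the base point. -/
def endpoint (γ : PiOne X x₀) : U.space :=
  (U.isCoveringMap.monodromy (x := x₀) (y := x₀) γ.unop ⟨U.base, U.proj_base⟩).1

theorem proj_endpoint (γ : PiOne X x₀) : U.proj (U.endpoint γ) = x₀ :=
  (U.isCoveringMap.monodromy (x := x₀) (y := x₀) γ.unop ⟨U.base, U.proj_base⟩).2

variable [LocallyPathConnectedSpace X]

theorem existsUnique_deck (γ : PiOne X x₀) :
    ∃! F : C(U.space, U.space), F U.base = U.endpoint γ ∧ U.proj ∘ F = U.proj :=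
  U.isCoveringMap.existsUnique_continuousMap_lifts ⟨U.proj, U.isCoveringMap.continuous⟩ U.base
    (U.endpoint γ) ((U.proj_endpoint γ).trans U.proj_base.symm)

/-- The deck transformation of `γ`: the map over `X` that sends the base point to the end point of
the lift of `γ`. -/
def deck (γ : PiOne X x₀) : C(U.space, U.space) := (U.existsUnique_deck γ).choose

theorem deck_base (γ : PiOne X x₀) : U.deck γ U.base = U.endpoint γ :=
  (U.existsUnique_deck γ).choose_spec.1.1

theorem proj_comp_deck (γ : PiOne X x₀) : U.proj ∘ U.deck γ = U.proj :=
  (U.existsUnique_deck γ).choose_spec.1.2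

theorem eq_deck {γ : PiOne X x₀} {F : C(U.space, U.space)} (h : F U.base = U.endpoint γ)
    (h' : U.proj ∘ F = U.proj) : F = U.deck γ :=
  (U.existsUnique_deck γ).choose_spec.2 F ⟨h, h'⟩

theorem deck_one : U.deck 1 = ContinuousMap.id _ := by
  refine (U.eq_deck ?_ rfl).symm
  exact congrArg Subtype.val (congrFun (U.isCoveringMap.monodromy_refl (x := x₀)) ⟨U.base, U.proj_base⟩).symm

theorem deck_endpoint (γ γ' : PiOne X x₀) : U.deck γ (U.endpoint γ') = U.endpoint (γ * γ') := by
  obtain ⟨γ⟩ := γ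
  obtain ⟨γ'⟩ := γ'
  change U.deck ⟨γ⟩ _ = (U.isCoveringMap.monodromy (x := x₀) (y := x₀)
    (Path.Homotopic.Quotient.trans γ γ') ⟨U.base, U.proj_base⟩).1
  rw [U.isCoveringMap.monodromy_trans_apply]
  have hb := U.deck_base ⟨γ⟩
  have hp := U.proj_comp_deck ⟨γ⟩
  set F := U.deck ⟨γ⟩
  change F U.base = (U.isCoveringMap.monodromy (x := x₀) (y := x₀) γ ⟨U.base, U.proj_base⟩).1 at hb
  revert hb
  generalize U.isCoveringMap.monodromy (x := x₀) (y := x₀) γ ⟨U.base, U.proj_base⟩ = e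
  intro hb
  obtain ⟨γ'⟩ := γ'
  change F (U.isCoveringMap.liftPath γ' U.base _ 1) = U.isCoveringMap.liftPath γ' e.1 _ 1
  have key : F.comp (U.isCoveringMap.liftPath γ' U.base (γ'.source.trans U.proj_base.symm)) =
      U.isCoveringMap.liftPath γ' e.1 (γ'.source.trans e.2.symm) := by
    rw [U.isCoveringMap.eq_liftPath_iff']
    refine ⟨?_, ?_⟩
    · rw [ContinuousMap.coe_comp, ← Function.comp_assoc, hp, U.isCoveringMap.liftPath_lifts]
    · rw [ContinuousMap.comp_apply, U.isCoveringMap.liftPath_zero, hb]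
  exact congrArg (fun H : C(unitInterval, U.space) => H 1) key

theorem deck_mul (γ γ' : PiOne X x₀) : U.deck (γ * γ') = (U.deck γ).comp (U.deck γ') := by
  refine (U.eq_deck ?_ ?_).symm
  · rw [ContinuousMap.comp_apply, U.deck_base, U.deck_endpoint]
  · rw [ContinuousMap.coe_comp, ← Function.comp_assoc, U.proj_comp_deck, U.proj_comp_deck]

end UniversalCover

end UniversalCover

section Triangulation

open scoped Manifold ContDiff

universe v w

/-- The closed simplex with vertex set `s`, inside the standard simplex on all vertices. -/
def closedSimplex {N : ℕ} (s : Finset (Fin N)) : Set (Fin N → ℝ) :=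
  {x | x ∈ stdSimplex ℝ (Fin N) ∧ ∀ i, x i ≠ 0 → i ∈ s}

/-- The geometric realization of a finite simplicial complex: the union of its closed simplices. -/
def realization {N : ℕ} (K : AbstractSimplicialComplex (Fin N)) : Set (Fin N → ℝ) :=
  {x | ∃ s ∈ K.faces, x ∈ closedSimplex s}

/-- A `C¹`-triangulation of a compact manifold: a homeomorphism from the realization of a finite
simplicial complex that is `C¹`, with injective differential, on each closed simplex. The vertices
are numbered, which orients the simplices. -/
structure Triangulation (d : ℕ) (M : Type v) [TopologicalSpace M]
    [ChartedSpace (EuclideanSpace ℝ (Fin d)) M] where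
  /-- The number of vertices. -/
  numVertices : ℕ
  /-- The simplicial complex. -/
  complex : AbstractSimplicialComplex (Fin numVertices)
  /-- The homeomorphism with `M`. -/
  homeo : realization complex ≃ₜ M
  contMDiff : ∀ s ∈ complex.faces, ∃ f : (Fin numVertices → ℝ) → M,
    (∀ x : realization complex, x.1 ∈ closedSimplex s → f x.1 = homeo x) ∧
    ContMDiffOn 𝓘(ℝ, Fin numVertices → ℝ) (𝓡 d) 1 f (closedSimplex s) ∧
    ∀ x ∈ closedSimplex s, ∀ y : Fin numVertices → ℝ, ∑ i, y i = 0 → (∀ i, y i ≠ 0 → i ∈ s) →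
      mfderivWithin 𝓘(ℝ, Fin numVertices → ℝ) (𝓡 d) f (closedSimplex s) x y = 0 → y = 0

namespace Triangulation

variable {d : ℕ} {M : Type v} [TopologicalSpace M] [ChartedSpace (EuclideanSpace ℝ (Fin d)) M]
  (T : Triangulation d M)

theorem succAbove_comp_succAbove {n : ℕ} {i j : Fin (n + 2)} (h : i ≤ j) :
    j.succ.succAbove ∘ i.succAbove = i.castSucc.succAbove ∘ j.succAbove := by
  ext k
  dsimp [Fin.succAbove]
  rcases i with ⟨i, _⟩
  rcases j with ⟨j, _⟩
  rcases k with ⟨k, _⟩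
  split_ifs <;> · simp at * <;> lia

/-- The `n`-simplices of the triangulation, with vertices in increasing order. -/
def Simplex (n : ℕ) : Type :=
  {σ : Fin (n + 1) ↪o Fin T.numVertices // Finset.univ.map σ.toEmbedding ∈ T.complex.faces}

/-- The face of a simplex opposite to its `i`-th vertex. -/
def Simplex.face {n : ℕ} (i : Fin (n + 2)) (σ : T.Simplex (n + 1)) : T.Simplex n :=
  ⟨i.succAboveOrderEmb.trans σ.1, by
    refine (T.complex.isRelLowerSet_faces σ.2).2 ?_ (by simp)
    intro x hx
    simp only [Finset.mem_map, Finset.mem_univ, true_and] at hx ⊢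
    obtain ⟨j, rfl⟩ := hx
    exact ⟨i.succAbove j, rfl⟩⟩

theorem Simplex.face_face {n : ℕ} (σ : T.Simplex (n + 2)) (i j : Fin (n + 2)) (h : i ≤ j) :
    Simplex.face T i (Simplex.face T j.succ σ) = Simplex.face T j (Simplex.face T i.castSucc σ) := by
  apply Subtype.ext
  apply RelEmbedding.ext
  intro k
  exact congrArg σ.1 (congrFun (succAbove_comp_succAbove h) k)

theorem map_mem_realization {n : ℕ} (σ : T.Simplex n) (t : stdSimplex ℝ (Fin (n + 1))) :
    (stdSimplex.map σ.1 t).1 ∈ realization T.complex := by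
  refine ⟨_, σ.2, (stdSimplex.map σ.1 t).2, fun i hi => ?_⟩
  by_contra h
  refine hi ?_
  change FunOnFinite.linearMap ℝ ℝ σ.1 t i = 0
  rw [FunOnFinite.linearMap_apply_apply]
  refine Finset.sum_eq_zero fun j hj => ?_
  exact absurd (Finset.mem_map.2 ⟨j, Finset.mem_univ _, (Finset.mem_filter.1 hj).2⟩) h

/-- The characteristic map `Δⁿ → M` of a simplex. -/
def charMap {n : ℕ} (σ : T.Simplex n) : C(stdSimplex ℝ (Fin (n + 1)), M) where
  toFun t := T.homeo ⟨(stdSimplex.map σ.1 t).1, T.map_mem_realization σ t⟩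
  continuous_toFun := T.homeo.continuous.comp
    ((continuous_subtype_val.comp (stdSimplex.continuous_map _)).subtype_mk _)

/-- The inclusion of the `i`-th face of the standard simplex. -/
def faceInclusion {n : ℕ} (i : Fin (n + 2)) :
    C(stdSimplex ℝ (Fin (n + 1)), stdSimplex ℝ (Fin (n + 2))) :=
  ⟨stdSimplex.map i.succAbove, stdSimplex.continuous_map _⟩

theorem charMap_face {n : ℕ} (i : Fin (n + 2)) (σ : T.Simplex (n + 1)) :
    T.charMap (Simplex.face T i σ) = (T.charMap σ).comp (faceInclusion i) := by
  ext t
  refine congrArg T.homeo (Subtype.ext ?_)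
  exact congrArg (fun y : stdSimplex ℝ (Fin T.numVertices) => y.1)
    (stdSimplex.map_comp_apply i.succAbove σ.1 t).symm

/-- The simplices of the triangulation of `M`, with their faces. -/
def deltaSet : DeltaSet.{0} where
  simplex := T.Simplex
  face := Simplex.face T
  face_face := Simplex.face_face T

/-- The Euler characteristic of the triangulated manifold `M`, `χ(M) = ∑ (-1)ⁱ rank H_i(M; ℤ)`. -/
def eulerCharacteristic : ℤ := T.deltaSet.chainComplex.homologyEulerChar

section Lifts

variable [LocallyPathConnectedSpace M] {x₀ : M} (U : UniversalCover.{v, w} M x₀)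

/-- The `n`-simplices of the lifted triangulation of the universal cover: lifts of the
characteristic maps of the `n`-simplices of `M`. -/
@[ext] structure LiftedSimplex (n : ℕ) where
  /-- The simplex of `M` that is lifted. -/
  simplex : T.Simplex n
  /-- The lift. -/
  lift : C(stdSimplex ℝ (Fin (n + 1)), U.space)
  proj_comp_lift : U.proj ∘ lift = T.charMap simplex

/-- The fundamental group acts on the lifted simplices by deck transformations. -/
instance (n : ℕ) : MulAction (PiOne M x₀) (T.LiftedSimplex U n) where
  smul γ τ := ⟨τ.simplex, (U.deck γ).comp τ.lift, by
    rw [ContinuousMap.coe_comp, ← Function.comp_assoc, U.proj_comp_deck, τ.proj_comp_lift]⟩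
  one_smul τ := LiftedSimplex.ext rfl (by
    change (U.deck 1).comp τ.lift = τ.lift
    rw [U.deck_one, ContinuousMap.id_comp])
  mul_smul γ γ' τ := LiftedSimplex.ext rfl (by
    change (U.deck (γ * γ')).comp τ.lift = (U.deck γ).comp ((U.deck γ').comp τ.lift)
    rw [U.deck_mul, ContinuousMap.comp_assoc])

/-- The lifted triangulation of the universal cover, with the action of the fundamental group. -/
def liftedDeltaSet : EquivariantDeltaSet.{w} (PiOne M x₀) where
  simplex := T.LiftedSimplex U
  face i τ := ⟨Simplex.face T i τ.simplex, τ.lift.comp (faceInclusion i), by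
    rw [T.charMap_face, ContinuousMap.coe_comp, ← Function.comp_assoc, τ.proj_comp_lift]
    rfl⟩
  face_face τ i j h := LiftedSimplex.ext (Simplex.face_face T τ.simplex i j h) (by
    ext t
    refine congrArg τ.lift ?_
    change stdSimplex.map _ (stdSimplex.map _ t) = stdSimplex.map _ (stdSimplex.map _ t)
    rw [stdSimplex.map_comp_apply, stdSimplex.map_comp_apply]
    exact congrArg (fun φ => stdSimplex.map φ t) (succAbove_comp_succAbove h))
  action _ := inferInstance
  face_smul _ _ _ := rfl

end Lifts

variable {x₀ : M} (U : UniversalCover.{v, w} M x₀)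

/-- The complex `C_•(M, u) = Λ_u ⊗_Λ C_•(M)`, where `C_•(M)` is the complex of the lifted
triangulation of the universal cover, over the group ring `Λ = ℤ[π₁(M)]`. -/
def novikovComplex (u : PiOne M x₀ →* Multiplicative ℝ) :
    ChainComplex (ModuleCat.{max v w} (NovikovRing u)) ℕ :=
  haveI : LocallyPathConnectedSpace M :=
    ChartedSpace.locallyPathConnectedSpace (EuclideanSpace ℝ (Fin d)) M
  (T.liftedDeltaSet U).completedChainComplex u

/-- The Novikov homology `H_i(M, u)`. -/
def novikovHomology (u : PiOne M x₀ →* Multiplicative ℝ) (i : ℕ) :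
    ModuleCat.{max v w} (NovikovRing u) :=
  (T.novikovComplex U u).homology i

end Triangulation

end Triangulation

end Novikov

end

open scoped Manifold ContDiff

/-
The coefficient of `1` is a trace on `Λ_u`: it is additive, takes the same value on `ab` and `ba`,
and sends `1` to `1`. The complex `C_•(M, u)` is bounded and free over `Λ_u` with one basis element
for each simplex of `M`. If it is acyclic, it is contractible, so its identity is homotopic to zero
and the alternating sum of the traces of the identity, which is `χ(M)`, vanishes. The same argument
applies to every coefficient ring with a trace.
-/

noncomputable section

namespace Novikov

section Trace

variable {S A : Type*} [Ring S] [AddCommGroup A] (τ : S →+ A)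
  {ι κ M N : Type*} [Fintype ι] [Fintype κ] [AddCommGroup M] [Module S M] [AddCommGroup N]
  [Module S N]

/-- The trace `∑ i, τ (φᵢᵢ)` of the matrix of an endomorphism of a free module over a ring `S` that
need not be commutative, read through an additive map `τ` on `S`. -/
def traceWith (b : Module.Basis ι S M) : Module.End S M →+ A where
  toFun φ := ∑ i, τ (b.repr (φ (b i)) i)
  map_zero' := by simp
  map_add' φ ψ := by simp [Finset.sum_add_distrib]

theorem traceWith_apply (b : Module.Basis ι S M) (φ : Module.End S M) :
    traceWith τ b φ = ∑ i, τ (b.repr (φ (b i)) i) := rfl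

theorem traceWith_id (b : Module.Basis ι S M) :
    traceWith τ b LinearMap.id = Fintype.card ι • τ 1 := by
  simp [traceWith_apply]

theorem traceWith_comp (b : Module.Basis ι S M) (c : Module.Basis κ S N) (φ : M →ₗ[S] N)
    (ψ : N →ₗ[S] M) :
    traceWith τ b (ψ ∘ₗ φ) = ∑ i, ∑ j, τ (c.repr (φ (b i)) j * b.repr (ψ (c j)) i) := by
  refine Finset.sum_congr rfl fun i _ => ?_
  rw [LinearMap.comp_apply]
  conv_lhs => rw [← c.sum_repr (φ (b i))]
  simp only [map_sum, map_smul, Finsupp.finsetSum_apply, Finsupp.smul_apply, smul_eq_mul]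

variable {τ}

theorem traceWith_comp_comm (hτ : ∀ s t, τ (s * t) = τ (t * s)) (b : Module.Basis ι S M)
    (c : Module.Basis κ S N) (φ : M →ₗ[S] N) (ψ : N →ₗ[S] M) :
    traceWith τ b (ψ ∘ₗ φ) = traceWith τ c (φ ∘ₗ ψ) := by
  simp only [traceWith_comp τ b c, traceWith_comp τ c b, hτ (b.repr _ _)]
  exact Finset.sum_comm

end Trace

section EulerCharacteristic

open CategoryTheory Limits ZeroObject

theorem sum_range_neg_one_pow_smul_add_succ {A : Type*} [AddCommGroup A] (r : ℕ → A) (N : ℕ) :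
    ∑ n ∈ Finset.range N, (-1 : ℤ) ^ n • (r n + r (n + 1)) = r 0 - (-1 : ℤ) ^ N • r N := by
  simpa [smul_add, pow_succ, sub_eq_add_neg] using
    Finset.sum_range_sub' (fun n => (-1 : ℤ) ^ n • r n) N

theorem sum_range_traceWith_eq_of_homotopy {S A : Type*} [Ring S] [AddCommGroup A] {τ : S →+ A}
    (hτ : ∀ s t, τ (s * t) = τ (t * s)) {C : ChainComplex (ModuleCat S) ℕ} {ι : ℕ → Type*}
    [∀ n, Fintype (ι n)] (b : ∀ n, Module.Basis (ι n) S (C.X n)) {φ ψ : C ⟶ C}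
    (H : Homotopy φ ψ) (N : ℕ) [IsEmpty (ι N)] :
    ∑ n ∈ Finset.range N, (-1 : ℤ) ^ n • traceWith τ (b n) (φ.f n).hom =
      ∑ n ∈ Finset.range N, (-1 : ℤ) ^ n • traceWith τ (b n) (ψ.f n).hom := by
  let r (n : ℕ) : A := traceWith τ (b n) (dNext n H.hom).hom
  have r_zero : r 0 = 0 := by simp [r]
  have r_N : r N = 0 := by simp [r, traceWith_apply]
  have prev (n : ℕ) : traceWith τ (b n) (prevD n H.hom).hom = r (n + 1) := by
    simp only [r, Homotopy.prevD_chainComplex, Homotopy.dNext_succ_chainComplex,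
      ModuleCat.hom_comp]
    exact traceWith_comp_comm hτ _ _ _ _
  have comm (n : ℕ) : traceWith τ (b n) (φ.f n).hom =
      r n + r (n + 1) + traceWith τ (b n) (ψ.f n).hom := by
    rw [H.comm n, ModuleCat.hom_add, ModuleCat.hom_add, map_add, map_add, prev]
  simp only [comm, smul_add _ (r _ + _), Finset.sum_add_distrib,
    sum_range_neg_one_pow_smul_add_succ, r_zero, r_N, smul_zero, sub_zero, zero_add]

theorem nonempty_homotopy_id_zero_of_exactAt {𝒜 : Type*} [Category 𝒜] [Abelian 𝒜]
    (C : ChainComplex 𝒜 ℕ) (hproj : ∀ n, Projective (C.X n)) (hC : ∀ n, C.ExactAt n) :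
    Nonempty (Homotopy (𝟙 C) 0) := by
  -- `C` is a projective resolution of `0`, and lifts of a map to resolutions are homotopic.
  have hzero : IsZero ((ChainComplex.single₀ 𝒜).obj 0) := Functor.map_isZero _ (isZero_zero 𝒜)
  let P : ProjectiveResolution (0 : 𝒜) :=
    { complex := C
      projective := hproj
      π := 0
      quasiIso := ⟨fun n => (quasiIsoAt_iff_exactAt _ n (hC n)).2 <|
        (HomologicalComplex.exactAt_iff_isZero_homology _ _).2 <|
          Functor.map_isZero (HomologicalComplex.homologyFunctor 𝒜 _ n) hzero⟩ }
  exact ⟨ProjectiveResolution.liftHomotopyZero (P := P) (Q := P) (𝟙 C) comp_zero⟩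

theorem sum_range_card_smul_eq_zero_of_exactAt {S A : Type*} [Ring S] [AddCommGroup A] {τ : S →+ A}
    (hτ : ∀ s t, τ (s * t) = τ (t * s)) {C : ChainComplex (ModuleCat S) ℕ} {ι : ℕ → Type*}
    [∀ n, Fintype (ι n)] (b : ∀ n, Module.Basis (ι n) S (C.X n)) (hC : ∀ n, C.ExactAt n) (N : ℕ)
    [IsEmpty (ι N)] :
    (∑ n ∈ Finset.range N, (-1 : ℤ) ^ n * Fintype.card (ι n)) • τ 1 = 0 := by
  obtain ⟨H⟩ := nonempty_homotopy_id_zero_of_exactAt C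
    (fun n => ModuleCat.projective_of_free (b n)) hC
  simpa [traceWith_id, Finset.sum_smul, mul_smul] using
    sum_range_traceWith_eq_of_homotopy hτ b H N

theorem finrank_eq_finrank_homology_add {R : Type*} [CommRing R] [IsDomain R]
    (S : ShortComplex (ModuleCat R)) [Module.Finite R S.X₂] [IsNoetherianRing R] :
    Module.finrank R S.X₂ = Module.finrank R S.homology +
      (Module.finrank R S.g.hom.range + Module.finrank R S.f.hom.range) := by
  have hhom : Module.finrank R S.homology =
      Module.finrank R (S.g.hom.ker ⧸ S.moduleCatToCycles.range) :=
    S.moduleCatHomologyIso.toLinearEquiv.finrank_eq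
  have hboundaries : Module.finrank R S.f.hom.range =
      Module.finrank R S.moduleCatToCycles.range := by
    have hcomp : S.f.hom = S.g.hom.ker.subtype ∘ₗ S.moduleCatToCycles := rfl
    rw [hcomp, LinearMap.range_comp, Submodule.finrank_map_subtype_eq]
  rw [hhom, hboundaries, ← S.g.hom.quotKerEquivRange.finrank_eq, add_left_comm,
    Submodule.finrank_quotient_add_finrank, Submodule.finrank_quotient_add_finrank]

theorem homologyEulerChar_eq_sum_range {R : Type*} [CommRing R] [IsDomain R] [IsNoetherianRing R]
    (C : ChainComplex (ModuleCat R) ℕ) [∀ n, Module.Finite R (C.X n)] {N : ℕ}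
    (hN : ∀ n, N ≤ n → Module.finrank R (C.X n) = 0) :
    C.homologyEulerChar = ∑ n ∈ Finset.range N, (-1 : ℤ) ^ n * Module.finrank R (C.X n) := by
  let r (n : ℕ) : ℕ := Module.finrank R (C.d n ((ComplexShape.down ℕ).next n)).hom.range
  have rank_f (n : ℕ) : Module.finrank R (C.sc n).f.hom.range = r (n + 1) := by
    change Module.finrank R (C.d ((ComplexShape.down ℕ).prev n) n).hom.range = r (n + 1)
    dsimp only [r]
    rw [ChainComplex.prev, ChainComplex.next_nat_succ]
  have rank_X (n : ℕ) :
      Module.finrank R (C.X n) = Module.finrank R (C.homology n) + (r n + r (n + 1)) := by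
    have : Module.Finite R (C.sc n).X₂ := inferInstanceAs (Module.Finite R (C.X n))
    rw [← rank_f]
    exact finrank_eq_finrank_homology_add (C.sc n)
  have r_zero : r 0 = 0 := by
    dsimp only [r]
    rw [ChainComplex.next_nat_zero, C.shape 0 0 (by simp), ModuleCat.hom_zero,
      LinearMap.range_zero, finrank_bot]
  have r_N : r N = 0 := by
    have := rank_X N
    have := hN N le_rfl
    omega
  have supp : GradedObject.finrankSupport (fun n => C.homology n) ⊆ Finset.range N := by
    refine (GradedObject.finrankSupport_subset_iff _ _).2 fun n hn => ?_
    have := rank_X n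
    have := hN n (by simpa using hn)
    omega
  have telescope := sum_range_neg_one_pow_smul_add_succ (fun n => (r n : ℤ)) N
  simp only [smul_eq_mul, r_zero, r_N, Nat.cast_zero, mul_zero, sub_zero] at telescope
  rw [HomologicalComplex.homologyEulerChar_eq_sum_finSet_of_finrankSupport_subset C
    (Finset.range N) supp]
  simp only [rank_X, Nat.cast_add, mul_add _ (Module.finrank R (C.homology _) : ℤ),
    Finset.sum_add_distrib, telescope, add_zero]
  rfl

end EulerCharacteristic

namespace BaseChange

open TensorProduct

variable {R S : Type*} [Ring R] [Ring S] (f : R →+* S) {C N : Type*} [AddCommGroup C] [Module R C]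
  [AddCommGroup N] [Module S N]

/-- The universal `f`-semilinear map `c ↦ 1 ⊗ c` from an `R`-module `C` to `S ⊗_R C`. -/
def mk : C →ₛₗ[f] BaseChange f C where
  toFun := tmul f 1
  map_add' c c' := by
    rw [tmul, TensorProduct.tmul_add]
    exact (balancingRelations f C).mkQ.map_add _ _
  map_smul' r c := by
    have h := (Submodule.Quotient.eq (balancingRelations f C)).2
      (Submodule.subset_span ⟨1, r, c, rfl⟩)
    rw [one_mul, ← mul_one (f r), ← smul_eq_mul, ← TensorProduct.smul_tmul'] at h
    exact h.symm

variable {f}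

theorem smul_mk (s : S) (c : C) : s • mk f c = tmul f s c :=
  congrArg (tmul f · c) (mul_one s)

theorem hom_ext_mk {φ ψ : BaseChange f C →ₗ[S] N} (h : φ.comp (mk f) = ψ.comp (mk f)) : φ = ψ :=
  hom_ext f fun s c => by
    rw [← smul_mk, map_smul, map_smul]
    exact congrArg (s • ·) (LinearMap.congr_fun h c)

/-- The `S`-linear map `s ⊗ c ↦ s • φ c` induced by an `f`-semilinear map `φ`. -/
def lift (φ : C →ₛₗ[f] N) : BaseChange f C →ₗ[S] N :=
  (balancingRelations f C).liftQ
    (TensorProduct.AlgebraTensorModule.lift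
      (LinearMap.toSpanSingleton S (C →ₗ[ℤ] N) φ.toAddMonoidHom.toIntLinearMap)) (by
    refine Submodule.span_le.2 ?_
    rintro _ ⟨s, r, c, rfl⟩
    simp [mul_smul])

theorem lift_mk (φ : C →ₛₗ[f] N) (c : C) : lift φ (mk f c) = φ c := one_smul S (φ c)

variable (f) in
/-- An `R`-basis of `C` induces an `S`-basis of `S ⊗_R C`. -/
def basis {ι : Type*} (b : Module.Basis ι R C) : Module.Basis ι S (BaseChange f C) :=
  .ofRepr <| .ofLinearMap
    (lift ((Finsupp.mapRange.linearMap f.toSemilinearMap).comp b.repr.toLinearMap))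
    (Finsupp.linearCombination S fun i => mk f (b i))
    (by
      refine Finsupp.lhom_ext' fun i => LinearMap.ext_ring ?_
      simp [lift_mk])
    (by
      refine hom_ext_mk (b.ext fun i => ?_)
      simp [lift_mk])

end BaseChange

section FreeAction

variable {G X ι : Type*} [Group G] [MulAction G X]

theorem exists_equiv_prod_of_existsUnique_smul {q : X → ι} (hq : Function.Surjective q)
    (hinv : ∀ (g : G) (x : X), q (g • x) = q x)
    (hfree : ∀ x y, q x = q y → ∃! g : G, g • x = y) :
    ∃ e : X ≃ G × ι, ∀ (g : G) (x : X), e (g • x) = (g * (e x).1, (e x).2) := by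
  choose s hs using hq
  have hbij : Function.Bijective fun p : G × ι => p.1 • s p.2 := by
    refine ⟨fun ⟨g, i⟩ ⟨g', i'⟩ h => ?_, fun x => ?_⟩
    · have hi : i = i' := by simpa only [hinv, hs] using congrArg q h
      subst hi
      exact congrArg (·, i) ((hfree (s i) _ (hinv g' _).symm).unique h rfl)
    · obtain ⟨g, hg, -⟩ := hfree (s (q x)) x (hs _)
      exact ⟨(g, q x), hg⟩
  refine ⟨(Equiv.ofBijective _ hbij).symm, fun g x => ?_⟩
  obtain ⟨p, rfl⟩ := (Equiv.ofBijective _ hbij).surjective x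
  rw [Equiv.symm_apply_apply, Equiv.symm_apply_eq]
  exact (mul_smul g p.1 (s p.2)).symm

variable (e : X ≃ G × ι) (he : ∀ (g : G) (x : X), e (g • x) = (g * (e x).1, (e x).2))

/-- The permutation representation of a free `G`-set `X ≃ G × ι` is a free representation. -/
def permRepEquivFree : (permRep G X).Equiv (Representation.free ℤ G ι) :=
  .mk (Finsupp.domLCongr (e.trans (Equiv.prodComm G ι)) ≪≫ₗ Finsupp.curryLinearEquiv ℤ ≪≫ₗ
    Finsupp.mapRange.linearEquiv (MonoidAlgebra.coeffLinearEquiv ℤ).symm) fun g => by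
      refine Finsupp.lhom_ext' fun x => LinearMap.ext_ring ?_
      simp [permRep, he]

/-- The basis of the permutation module of a free `G`-set `X ≃ G × ι` over the group ring that is
formed by the points over `{1} × ι`. -/
def permRepBasis : Module.Basis ι (MonoidAlgebra ℤ G) (permRep G X).asModule :=
  (Representation.freeAsModuleBasis ℤ G ι).map <| LinearEquiv.symm <| .ofBijective
    (Representation.IntertwiningMap.equivLinearMapAsModule _ _
      (permRepEquivFree e he).toIntertwiningMap)
    (permRepEquivFree e he).toLinearEquiv.bijective

end FreeAction

namespace NovikovRing

variable {G : Type*} [Group G] {u : G →* Multiplicative ℝ}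

/-- The coefficient of the identity of `G`, which is the Kaplansky trace on `ℤ[G]`, extended to
formal series. -/
def identityCoeff (u : G →* Multiplicative ℝ) : NovikovRing u →+ ℤ where
  toFun a := a.coeff 1
  map_zero' := rfl
  map_add' _ _ := rfl

theorem identityCoeff_one : identityCoeff u 1 = 1 := coeff_single_self (u := u) 1

theorem identityCoeff_mul_comm (a b : NovikovRing u) :
    identityCoeff u (a * b) = identityCoeff u (b * a) := by
  change (a * b).coeff 1 = (b * a).coeff 1
  rw [coeff_mul, coeff_mul, ← finsum_comp_equiv (Equiv.inv G)]
  exact finsum_congr fun g => by simp [mul_comm]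

end NovikovRing

universe v w

theorem monodromy_left_injective {E X : Type*} [TopologicalSpace E] [TopologicalSpace X]
    [SimplyConnectedSpace E] {p : E → X} (hp : IsCoveringMap p) {x y : X} (e : p ⁻¹' {x}) :
    Function.Injective fun γ : Path.Homotopic.Quotient x y => hp.monodromy γ e := by
  have map_heq (γ : Path.Homotopic.Quotient x y) {e' : p ⁻¹' {y}} (h : hp.monodromy γ e = e')
      (Γ : Path.Homotopic.Quotient e.1 e') : Γ.map ⟨p, hp.continuous⟩ ≍ γ := by
    subst h
    rw [Subsingleton.elim Γ (hp.liftPathQuotient γ e), hp.map_liftPathQuotient]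
    exact γ.cast_heq _ _
  intro γ γ' h
  exact eq_of_heq <| (map_heq γ h (hp.liftPathQuotient γ' e)).symm.trans (map_heq γ' rfl _)

namespace UniversalCover

variable {X : Type v} [TopologicalSpace X] {x₀ : X} (U : UniversalCover.{v, w} X x₀)

theorem endpoint_injective : Function.Injective U.endpoint := fun _ _ h =>
  MulOpposite.unop_injective (monodromy_left_injective U.isCoveringMap _ (Subtype.ext h))

theorem exists_endpoint_eq {e : U.space} (he : U.proj e = x₀) : ∃ γ, U.endpoint γ = e := by
  obtain ⟨p⟩ := PathConnectedSpace.joined U.base e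
  let Γ := Path.Homotopic.Quotient.mk p
  let γ := (Γ.map ⟨U.proj, U.isCoveringMap.continuous⟩).cast U.proj_base.symm he.symm
  exact ⟨.op γ, congrArg Subtype.val <|
    U.isCoveringMap.monodromy_eq_of_map_eq (ey := ⟨e, he⟩) Γ rfl⟩

theorem proj_surjective [PathConnectedSpace X] : Function.Surjective U.proj := by
  intro x
  obtain ⟨p⟩ := PathConnectedSpace.joined x₀ x
  obtain ⟨Γ, hΓ, -⟩ :=
    U.isCoveringMap.exists_path_lifts p U.base (p.source.trans U.proj_base.symm)
  exact ⟨Γ 1, (congrFun hΓ 1).trans p.target⟩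

variable [LocallyPathConnectedSpace X]

theorem exists_deck_eq {e e' : U.space} (h : U.proj e = U.proj e') : ∃ γ, U.deck γ e = e' := by
  obtain ⟨F, ⟨hF, hproj⟩, -⟩ := U.isCoveringMap.existsUnique_continuousMap_lifts
    ⟨U.proj, U.isCoveringMap.continuous⟩ e e' h.symm
  obtain ⟨γ, hγ⟩ := U.exists_endpoint_eq ((congrFun hproj U.base).trans U.proj_base)
  exact ⟨γ, by rw [← U.eq_deck hγ.symm hproj, hF]⟩

theorem deck_apply_left_injective (e : U.space) : Function.Injective fun γ => U.deck γ e := by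
  intro γ γ' h
  have hdeck := U.isCoveringMap.eq_of_comp_eq (U.deck γ).continuous (U.deck γ').continuous
    ((U.proj_comp_deck γ).trans (U.proj_comp_deck γ').symm) e h
  apply U.endpoint_injective
  rw [← U.deck_base, ← U.deck_base, hdeck]

end UniversalCover

namespace Triangulation

variable {d : ℕ} {M : Type v} [TopologicalSpace M] [ChartedSpace (EuclideanSpace ℝ (Fin d)) M]
  (T : Triangulation d M) {x₀ : M} (U : UniversalCover.{v, w} M x₀)

instance (n : ℕ) : Finite (T.Simplex n) :=
  inferInstanceAs (Finite {σ : Fin (n + 1) ↪o Fin T.numVertices //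
    Finset.univ.map σ.toEmbedding ∈ T.complex.faces})

instance (n : ℕ) : Fintype (T.Simplex n) := Fintype.ofFinite _

theorem isEmpty_simplex {n : ℕ} (h : T.numVertices ≤ n) : IsEmpty (T.Simplex n) :=
  ⟨fun σ => by
    have := Fintype.card_le_of_embedding σ.1.toEmbedding
    simp only [Fintype.card_fin] at this
    omega⟩

theorem eulerCharacteristic_eq_sum_card : T.eulerCharacteristic =
    ∑ n ∈ Finset.range T.numVertices, (-1 : ℤ) ^ n * Fintype.card (T.Simplex n) := by
  have (n : ℕ) : Module.Finite ℤ (T.deltaSet.chainComplex.X n) :=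
    inferInstanceAs (Module.Finite ℤ (T.Simplex n →₀ ℤ))
  have finrank_X (n : ℕ) :
      Module.finrank ℤ (T.deltaSet.chainComplex.X n) = Fintype.card (T.Simplex n) :=
    Module.finrank_finsupp_self (ι := T.Simplex n) ℤ
  rw [eulerCharacteristic,
    homologyEulerChar_eq_sum_range T.deltaSet.chainComplex (N := T.numVertices)]
  · simp only [finrank_X]
  · intro n hn
    rw [finrank_X, Fintype.card_eq_zero_iff]
    exact T.isEmpty_simplex hn

theorem simplex_surjective [PathConnectedSpace M] (n : ℕ) :
    Function.Surjective (LiftedSimplex.simplex : T.LiftedSimplex U n → T.Simplex n) := by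
  intro σ
  have hconv := convex_stdSimplex ℝ (Fin (n + 1))
  let v : stdSimplex ℝ (Fin (n + 1)) := ⟨_, single_mem_stdSimplex ℝ 0⟩
  have : LocallyPathConnectedSpace (stdSimplex ℝ (Fin (n + 1))) := hconv.locallyPathConnectedSpace
  have : ContractibleSpace (stdSimplex ℝ (Fin (n + 1))) := hconv.contractibleSpace ⟨_, v.2⟩
  obtain ⟨e, he⟩ := U.proj_surjective (T.charMap σ v)
  obtain ⟨F, ⟨-, hF⟩, -⟩ := U.isCoveringMap.existsUnique_continuousMap_lifts (T.charMap σ) v e he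
  exact ⟨⟨σ, F, hF⟩, rfl⟩

section DeckAction

variable [LocallyPathConnectedSpace M]

theorem existsUnique_smul_eq {n : ℕ} (τ τ' : T.LiftedSimplex U n) (h : τ.simplex = τ'.simplex) :
    ∃! γ : PiOne M x₀, γ • τ = τ' := by
  let v : stdSimplex ℝ (Fin (n + 1)) := ⟨_, single_mem_stdSimplex ℝ 0⟩
  have hproj : U.proj ∘ τ.lift = U.proj ∘ τ'.lift := by
    rw [τ.proj_comp_lift, τ'.proj_comp_lift, h]
  obtain ⟨γ, hγ⟩ := U.exists_deck_eq (congrFun hproj v)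
  refine ⟨γ, LiftedSimplex.ext h ?_, fun γ' hγ' => ?_⟩
  · refine DFunLike.coe_injective (U.isCoveringMap.eq_of_comp_eq
      ((U.deck γ).comp τ.lift).continuous τ'.lift.continuous ?_ v hγ)
    change U.proj ∘ U.deck γ ∘ τ.lift = _
    rw [← Function.comp_assoc, U.proj_comp_deck, hproj]
  · exact U.deck_apply_left_injective (τ.lift v) <|
      (congrArg (fun τ : T.LiftedSimplex U n => τ.lift v) hγ').trans hγ.symm

theorem exists_liftedSimplex_equiv_prod [PathConnectedSpace M] (n : ℕ) :
    ∃ e : T.LiftedSimplex U n ≃ PiOne M x₀ × T.Simplex n,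
      ∀ (γ : PiOne M x₀) (τ : T.LiftedSimplex U n), e (γ • τ) = (γ * (e τ).1, (e τ).2) :=
  exists_equiv_prod_of_existsUnique_smul (T.simplex_surjective U n) (fun _ _ => rfl)
    (T.existsUnique_smul_eq U)

end DeckAction

variable {S : Type*} [Ring S] (f : MonoidAlgebra ℤ (PiOne M x₀) →+* S)

/-- The complex `S ⊗_Λ C_•(M)` of chains of `M` with coefficients in `S`, twisted by a ring
homomorphism `f : Λ → S` from the group ring `Λ` of the fundamental group. For `S = Λ_u` it is the
Novikov complex. -/
def twistedComplex : ChainComplex (ModuleCat S) ℕ :=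
  haveI : LocallyPathConnectedSpace M :=
    ChartedSpace.locallyPathConnectedSpace (EuclideanSpace ℝ (Fin d)) M
  ((baseChangeFunctor f).mapHomologicalComplex _).obj (T.liftedDeltaSet U).equivariantChainComplex

theorem nonempty_twistedComplex_basis [ConnectedSpace M] (n : ℕ) :
    Nonempty (Module.Basis (T.Simplex n) S ((T.twistedComplex U f).X n)) := by
  have := ChartedSpace.locallyPathConnectedSpace (EuclideanSpace ℝ (Fin d)) M
  have : PathConnectedSpace M := pathConnectedSpace_iff_connectedSpace.2 inferInstance
  obtain ⟨e, he⟩ := T.exists_liftedSimplex_equiv_prod U n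
  exact ⟨BaseChange.basis f (permRepBasis e he)⟩

end Triangulation

end Novikov

end

theorem proposition3p5_general {d : ℕ} {M : Type*} [TopologicalSpace M] [ConnectedSpace M]
    [ChartedSpace (EuclideanSpace ℝ (Fin d)) M] (T : Novikov.Triangulation d M) {x₀ : M}
    (U : Novikov.UniversalCover M x₀) {S A : Type*} [Ring S] [AddCommGroup A]
    (f : MonoidAlgebra ℤ (Novikov.PiOne M x₀) →+* S) {τ : S →+ A}
    (hτ : ∀ s t, τ (s * t) = τ (t * s)) (h : ∀ i : ℕ, (T.twistedComplex U f).ExactAt i) :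
    T.eulerCharacteristic • τ 1 = 0 := by
  have := T.isEmpty_simplex le_rfl
  rw [T.eulerCharacteristic_eq_sum_card]
  exact Novikov.sum_range_card_smul_eq_zero_of_exactAt hτ
    (fun n => (T.nonempty_twistedComplex_basis U f n).some) h T.numVertices

theorem proposition3p5 {d : ℕ} {M : Type*} [TopologicalSpace M] [T2Space M] [CompactSpace M]
    [ConnectedSpace M] [ChartedSpace (EuclideanSpace ℝ (Fin d)) M] [IsManifold (𝓡 d) ∞ M]
    (T : Novikov.Triangulation d M) (x₀ : M) (U : Novikov.UniversalCover M x₀)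
    (u : Novikov.PiOne M x₀ →* Multiplicative ℝ)
    (h : ∀ i : ℕ, CategoryTheory.Limits.IsZero (T.novikovHomology U u i)) :
    T.eulerCharacteristic = 0 := by
  have hχ := proposition3p5_general T U (Novikov.NovikovRing.ofGroupRing u)
    Novikov.NovikovRing.identityCoeff_mul_comm fun i =>
      (HomologicalComplex.exactAt_iff_isZero_homology _ i).2 (h i)
  rwa [Novikov.NovikovRing.identityCoeff_one, smul_eq_mul, mul_one] at hχ
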